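/- Let $\Gamma$ be a weighted digraph without loops on the vertex set $\{1,\dots,n\}$, $n>1$, with arc weights $\varepsilon_{ij}>0$ for every arc $(i,j)$ and $\varepsilon_{ij}=0$ if there is no arc from $i$ to $j$. A spanning diverging forest of $\Gamma$ is a spanning subgraph without circuits in which every vertex has indegree at most $1$; its roots are the vertices of indegree $0$. A maximum out forest is a spanning diverging forest with the maximum possible number of arcs. The weight of a subgraph is the product of the weights of its arcs ($1$ if it has none), and the weight of a set of subgraphs is the sum of the weights of its members. Let $\bar J=(\bar J_{ij})$, where $\bar J_{ij}$ is the weight of the set of all maximum out forests in which $j$ is a root and $i$ is reachable from $j$, divided by the weight of the set of all maximum out forests. Let $P=(p_{ij})=\bar J^{\mathsf T}$ be the matrix of limiting accessibilities. (A path is a directed path with distinct vertices; a single vertex $i$ is a path from $i$ to $i$. For the monotonicity condition, $\Delta p_{ij}$ is the change of $p_{ij}$ when the weight of one arc $(k,t)$ of $\Gamma$ is increased and all other weights are preserved.) A condition is satisfied if it holds for every such digraph, and for every such increase in the case of monotonicity. (a) The following are satisfied. Nonnegativity: $p_{ij}\ge 0$ for all $i,j$. The '$\Leftarrow$' part of the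 disconnection condition: if $j$ is unreachable from $i$, then $p_{ij}=0$. (b) The following are satisfied in the nonstrict form (with $\ge$ in place of $>$), but not in the strict form written here. Diagonal maximality: $p_{ii}>p_{ij}$ for all distinct $i,j$. Transit property: if $\Gamma$ contains a path from $i$ to $k$, $i\ne k\ne t$, and every path from $i$ to $t$ includes $k$, then $p_{ik}>p_{it}$. First part of item 1 of monotonicity: $\Delta p_{kt}>0$. Item 2 of monotonicity: for any $i$, if there is a path from $i$ to $k$ and each path from $i$ to $t$ includes $k$, then $\Delta p_{it}>\Delta p_{ik}$. (c) The following are not satisfied (nor are the nonstrict forms of those among them that contain strict inequalities). Reversal property: reversing all arcs of $\Gamma$ with their weights preserved transposes $P$. Triangle inequality for proximities: $p_{ij}+p_{ik}-p_{jk}\le p_{ii}$ for all $i,j,k$, with strict inequality if $j=k$ and $i\ne j$. Metric representability: $d_{ij}=p_{ii}+p_{jj}-p_{ij}-p_{ji}$ satisfies the axioms of a metric on the vertex set. The '$\Rightarrow$' part of the disconnection condition: if $p_{ij}=0$, then $j$ is unreachable from $i$. Second part of item 1 of monotonicity: $\Delta p_{kt}>\Delta p_{ij}$ for all $(i,j)\ne(k,t)$.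 -/

import Mathlib

/-- A weighted digraph without loops on the vertex set `Fin n`, given by its matrix of arc weights:
`weight i j` is positive if there is an arc from `i` to `j`, and zero otherwise. -/
structure WeightedDigraph (n : ℕ) where
  weight : Fin n → Fin n → ℝ
  weight_nonneg : ∀ i j, 0 ≤ weight i j
  weight_self : ∀ i, weight i i = 0

namespace WeightedDigraph

variable {n : ℕ}

/-- There is an arc from `i` to `j`. -/
def Arc (G : WeightedDigraph n) (i j : Fin n) : Prop := 0 < G.weight i j

/-- `j` is reachable from `i` (every vertex is reachable from itself). -/
def Reachable (G : WeightedDigraph n) (i j : Fin n) : Prop := Relation.ReflTransGen G.Arc i j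

/-- `l` is the list of vertices of a path from `i` to `j`: consecutive vertices are joined by arcs
and all vertices are different. The one-vertex list `[i]` is a path from `i` to `i`. -/
def IsPath (G : WeightedDigraph n) (i j : Fin n) (l : List (Fin n)) : Prop :=
  l.head? = some i ∧ l.getLast? = some j ∧ l.IsChain G.Arc ∧ l.Nodup

/-- The digraph in which all arcs are reversed and keep their weights. -/
def reverse (G : WeightedDigraph n) : WeightedDigraph n where
  weight i j := G.weight j i
  weight_nonneg i j := G.weight_nonneg j i
  weight_self i := G.weight_self i

/-- `G'` results from `G` by increasing the weight of the arc `(k, t)` of `G`, all other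
weights being preserved. -/
def IsArcIncrease (G G' : WeightedDigraph n) (k t : Fin n) : Prop :=
  G.Arc k t ∧ G.weight k t < G'.weight k t ∧
    ∀ i j, (i, j) ≠ (k, t) → G'.weight i j = G.weight i j

/-- Reachability in the spanning subgraph with arc set `F`. -/
def ForestReach (F : Finset (Fin n × Fin n)) (i j : Fin n) : Prop :=
  Relation.ReflTransGen (fun a b => (a, b) ∈ F) i j

/-- The spanning subgraph with arc set `F` is a diverging forest: it has no circuits and all
indegrees are at most one. -/
def IsDivergingForest (F : Finset (Fin n × Fin n)) : Prop :=
  (∀ a, ¬ Relation.TransGen (fun x y => (x, y) ∈ F) a a) ∧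
    ∀ a b c, (a, c) ∈ F → (b, c) ∈ F → a = b

/-- `r` is a root of the diverging forest with arc set `F`: its indegree is zero. -/
def IsRoot (F : Finset (Fin n × Fin n)) (r : Fin n) : Prop := ∀ a, (a, r) ∉ F

open Classical in
/-- The set of arcs. -/
noncomputable def arcs (G : WeightedDigraph n) : Finset (Fin n × Fin n) :=
  Finset.univ.filter fun e => G.Arc e.1 e.2

open Classical in
/-- The spanning diverging forests of `G`, each given by its set of arcs. -/
noncomputable def forests (G : WeightedDigraph n) : Finset (Finset (Fin n × Fin n)) :=
  G.arcs.powerset.filter fun F => IsDivergingForest F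

open Classical in
/-- The maximum out forests of `G`: spanning diverging forests with the largest number of arcs. -/
noncomputable def maxForests (G : WeightedDigraph n) : Finset (Finset (Fin n × Fin n)) :=
  G.forests.filter fun F => ∀ F' ∈ G.forests, F'.card ≤ F.card

open Classical in
/-- The maximum out forests of `G` in which `j` belongs to a tree diverging from `i`. -/
noncomputable def maxForestsFrom (G : WeightedDigraph n) (i j : Fin n) :
    Finset (Finset (Fin n × Fin n)) :=
  G.maxForests.filter fun F => IsRoot F i ∧ ForestReach F i j

/-- The weight of a set of subgraphs: the sum over its members of the product of the weights of
their arcs. -/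
noncomputable def setWeight (G : WeightedDigraph n) (S : Finset (Finset (Fin n × Fin n))) : ℝ :=
  ∑ F ∈ S, ∏ e ∈ F, G.weight e.1 e.2

/-- The normalized matrix of maximum out forests: the entry `(i, j)` is the weight of the set of
maximum out forests in which `i` belongs to a tree diverging from `j`, divided by the weight of
the set of all maximum out forests. -/
noncomputable def normalizedForestMatrix (G : WeightedDigraph n) : Matrix (Fin n) (Fin n) ℝ :=
  Matrix.of fun i j => G.setWeight (G.maxForestsFrom j i) / G.setWeight G.maxForests

end WeightedDigraph

/-- An index assigns to each weighted digraph a matrix with rows and columns indexed by its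
vertices. -/
abbrev ProximityIndex : Type := ∀ n : ℕ, WeightedDigraph n → Matrix (Fin n) (Fin n) ℝ

/-- The index of limiting accessibilities: the transpose of the normalized matrix of maximum out
forests. -/
noncomputable def limitingAccessibility : ProximityIndex :=
  fun _ G => G.normalizedForestMatrix.transpose

namespace ProximityIndex

/- The conditions on an index. Digraphs have more than one vertex. Where a condition contains strict
inequalities, the argument `r` is the comparison that is used: `(· > ·)` gives the condition
itself, `(· ≥ ·)` gives its nonstrict form. -/

def Nonnegativity (p : ProximityIndex) : Prop :=
  ∀ n : ℕ, 1 < n → ∀ (G : WeightedDigraph n) (i j : Fin n), 0 ≤ p n G i j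

def Reversal (p : ProximityIndex) : Prop :=
  ∀ n : ℕ, 1 < n → ∀ G : WeightedDigraph n, p n G.reverse = (p n G).transpose

def DiagonalMaximality (r : ℝ → ℝ → Prop) (p : ProximityIndex) : Prop :=
  ∀ n : ℕ, 1 < n → ∀ (G : WeightedDigraph n) (i j : Fin n), i ≠ j → r (p n G i i) (p n G i j)

def TriangleInequality (r : ℝ → ℝ → Prop) (p : ProximityIndex) : Prop :=
  ∀ n : ℕ, 1 < n → ∀ (G : WeightedDigraph n) (i j k : Fin n),
    p n G i i ≥ p n G i j + p n G i k - p n G j k ∧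
      (j = k → i ≠ j → r (p n G i i) (p n G i j + p n G i k - p n G j k))

/-- `d i j = p i i + p j j - p i j - p j i`. -/
def dist (p : ProximityIndex) {n : ℕ} (G : WeightedDigraph n) (i j : Fin n) : ℝ :=
  p n G i i + p n G j j - p n G i j - p n G j i

/-- `dist` satisfies the axioms of metrics. -/
def MetricRepresentability (p : ProximityIndex) : Prop :=
  ∀ n : ℕ, 1 < n → ∀ G : WeightedDigraph n,
    (∀ i j : Fin n, 0 ≤ p.dist G i j) ∧
    (∀ i j : Fin n, p.dist G i j = 0 ↔ i = j) ∧
    (∀ i j : Fin n, p.dist G i j = p.dist G j i) ∧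
    (∀ i j k : Fin n, p.dist G i k ≤ p.dist G i j + p.dist G j k)

/-- The implication from left to right in the disconnection condition
`p i j = 0 ↔ j is unreachable from i`. -/
def DisconnectionForward (p : ProximityIndex) : Prop :=
  ∀ n : ℕ, 1 < n → ∀ (G : WeightedDigraph n) (i j : Fin n), p n G i j = 0 → ¬ G.Reachable i j

/-- The implication from right to left in the disconnection condition
`p i j = 0 ↔ j is unreachable from i`. -/
def DisconnectionBackward (p : ProximityIndex) : Prop :=
  ∀ n : ℕ, 1 < n → ∀ (G : WeightedDigraph n) (i j : Fin n), ¬ G.Reachable i j → p n G i j = 0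

def Transit (r : ℝ → ℝ → Prop) (p : ProximityIndex) : Prop :=
  ∀ n : ℕ, 1 < n → ∀ (G : WeightedDigraph n) (i k t : Fin n),
    (∃ l, G.IsPath i k l) → i ≠ k → k ≠ t → (∀ l, G.IsPath i t l → k ∈ l) →
      r (p n G i k) (p n G i t)

/-- Monotonicity, item 1, first part. -/
def MonotonicityOneFirst (r : ℝ → ℝ → Prop) (p : ProximityIndex) : Prop :=
  ∀ n : ℕ, 1 < n → ∀ (G G' : WeightedDigraph n) (k t : Fin n), G.IsArcIncrease G' k t →
    r (p n G' k t - p n G k t) 0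

/-- Monotonicity, item 1, second part. -/
def MonotonicityOneSecond (r : ℝ → ℝ → Prop) (p : ProximityIndex) : Prop :=
  ∀ n : ℕ, 1 < n → ∀ (G G' : WeightedDigraph n) (k t : Fin n), G.IsArcIncrease G' k t →
    ∀ i j : Fin n, (i, j) ≠ (k, t) → r (p n G' k t - p n G k t) (p n G' i j - p n G i j)

/-- Monotonicity, item 2. -/
def MonotonicityTwo (r : ℝ → ℝ → Prop) (p : ProximityIndex) : Prop :=
  ∀ n : ℕ, 1 < n → ∀ (G G' : WeightedDigraph n) (k t : Fin n), G.IsArcIncrease G' k t →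
    ∀ i : Fin n, (∃ l, G.IsPath i k l) → (∀ l, G.IsPath i t l → k ∈ l) →
      r (p n G' i t - p n G i t) (p n G' i k - p n G i k)

end ProximityIndex

/-! Weight each diverging forest F by τ^|F| times its arc product, and let Q_τ(i,j) be the share of
the forests in which j lies in the tree rooted at i. As τ → ∞ only the forests with most arcs
survive, so Q_τ(i,j) → p_ij (`tendsto_forestAccessibility`), and nonstrict inequalities pass to the
limit.

At finite τ, diagonal maximality and transit are inclusions between sets of forests. Monotonicity
needs the matrix forest theorem (`treeSum_laplacian`): the transpose of Q_τ is the inverse of I +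
τL. Raising one arc weight changes one row of this matrix, so `forestAccessibility_sub` expresses
the change of Q_τ as a product whose factors have signs given by those inclusions. The matrix forest
theorem itself comes from deleting the arc that enters a fixed vertex (`sum_divergingForests`).

Most failures are seen on a directed path: it is its own only maximum forest, so the row of its
source consists of ones and all other rows vanish, whatever the weights. The second part of item 1
of monotonicity fails on a fork. -/

namespace WeightedDigraph

variable {n : ℕ}

/-! ### Diverging forests and the insertion of an arc into a root. -/

section Forest

variable {F : Finset (Fin n × Fin n)}

theorem IsDivergingForest.subset {F' : Finset (Fin n × Fin n)} (hF : IsDivergingForest F)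
    (h : F' ⊆ F) : IsDivergingForest F' :=
  ⟨fun a ha => hF.1 a (Relation.TransGen.mono (fun _ _ hxy => h hxy) _ _ ha),
    fun a b c ha hb => hF.2 a b c (h ha) (h hb)⟩

theorem IsRoot.eq_of_forestReach {i j : Fin n} (hi : IsRoot F i) (h : ForestReach F j i) :
    j = i := by
  rcases Relation.ReflTransGen.cases_tail h with h | ⟨c, _, hc⟩
  · exact h.symm
  · exact absurd hc (hi c)

/-- With indegrees at most one, the walk backwards from `x` is forced, so it can end at only one
root. -/
theorem IsDivergingForest.root_unique (hF : IsDivergingForest F) {i j x : Fin n}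
    (hi : IsRoot F i) (hj : IsRoot F j) (hix : ForestReach F i x) (hjx : ForestReach F j x) :
    i = j := by
  induction hix with
  | refl => exact (hi.eq_of_forestReach hjx).symm
  | @tail y x _ hyx ih =>
    rcases Relation.ReflTransGen.cases_tail hjx with h | ⟨c, hc, hcx⟩
    · subst h
      exact absurd hyx (hj y)
    · rw [hF.2 c y x hcx hyx] at hc
      exact ih hc

/-- Cut a walk that uses the new arc just before its first use and just after its last use. -/
theorem forestReach_insert_iff {a b x y : Fin n} :
    ForestReach (insert (a, b) F) x y ↔
      ForestReach F x y ∨ (ForestReach F x a ∧ ForestReach F b y) := by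
  have mono : ∀ {u v}, ForestReach F u v → ForestReach (insert (a, b) F) u v := fun h =>
    Relation.ReflTransGen.mono (fun _ _ huv => Finset.mem_insert_of_mem huv) _ _ h
  constructor
  · intro h
    induction h with
    | refl => exact Or.inl .refl
    | @tail y z _ hyz ih =>
      rcases Finset.mem_insert.1 hyz with h | h
      · obtain ⟨rfl, rfl⟩ := Prod.mk.inj h
        rcases ih with ih | ih
        · exact Or.inr ⟨ih, .refl⟩
        · exact Or.inr ⟨ih.1, .refl⟩
      · rcases ih with ih | ih
        · exact Or.inl (ih.tail h)
        · exact Or.inr ⟨ih.1, ih.2.tail h⟩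
  · rintro (h | ⟨h₁, h₂⟩)
    · exact mono h
    · exact ((mono h₁).tail (Finset.mem_insert_self _ _)).trans (mono h₂)

/-- A circuit through the new arc would contain a walk from `i` back to `k` in `F`; indegrees stay
at most one because nothing entered `i`. -/
theorem IsDivergingForest.insert_arc (hF : IsDivergingForest F) {k i : Fin n} (hi : IsRoot F i)
    (hk : ¬ ForestReach F i k) : IsDivergingForest (insert (k, i) F) := by
  refine ⟨fun c hc => ?_, fun a b c ha hb => ?_⟩
  · obtain ⟨d, hcd, hdc⟩ := Relation.TransGen.head'_iff.1 hc
    replace hdc := forestReach_insert_iff.1 hdc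
    rcases Finset.mem_insert.1 hcd with h | h
    · obtain ⟨rfl, rfl⟩ := Prod.mk.inj h
      exact hk (hdc.elim id And.left)
    · rcases hdc with hdc | ⟨h₁, h₂⟩
      · exact hF.1 c (.head' h hdc)
      · exact hk ((h₂.tail h).trans h₁)
  · rcases Finset.mem_insert.1 ha with ha' | ha' <;>
      rcases Finset.mem_insert.1 hb with hb' | hb'
    · exact (Prod.mk.inj ha').1.trans (Prod.mk.inj hb').1.symm
    · rw [(Prod.mk.inj ha').2] at hb'
      exact absurd hb' (hi b)
    · rw [(Prod.mk.inj hb').2] at ha'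
      exact absurd ha' (hi a)
    · exact hF.2 a b c ha' hb'

theorem isRoot_insert_iff {k i j : Fin n} :
    IsRoot (insert (k, i) F) j ↔ IsRoot F j ∧ j ≠ i := by
  constructor
  · refine fun h => ⟨fun a ha => h a (Finset.mem_insert_of_mem ha), ?_⟩
    rintro rfl
    exact h k (Finset.mem_insert_self _ _)
  · rintro ⟨h, hji⟩ a ha
    rcases Finset.mem_insert.1 ha with ha | ha
    · exact hji (Prod.mk.inj ha).2
    · exact h a ha

open Classical in
/-- The diverging forests on `Fin n`. -/
noncomputable def divergingForests (n : ℕ) : Finset (Finset (Fin n × Fin n)) :=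
  Finset.univ.filter IsDivergingForest

theorem mem_divergingForests : F ∈ divergingForests n ↔ IsDivergingForest F := by
  simp [divergingForests]

open Classical in
/-- A diverging forest arises in exactly one way from a forest with root `i`, by either adding
nothing or adding an arc to `i` from a vertex outside the tree of `i`. -/
theorem sum_divergingForests (i : Fin n) (g : Finset (Fin n × Fin n) → ℝ) :
    ∑ F ∈ divergingForests n, g F = ∑ H ∈ (divergingForests n).filter (IsRoot · i),
      (g H + ∑ k with ¬ ForestReach H i k, g (insert (k, i) H)) := by
  rw [← Finset.sum_filter_add_sum_filter_not _ (IsRoot · i), Finset.sum_add_distrib]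
  congr 1
  rw [Finset.sum_sigma']
  symm
  refine Finset.sum_bij (fun x _ => insert (x.2, i) x.1) ?_ ?_ ?_ (fun _ _ => rfl)
  · rintro ⟨H, k⟩ hx
    simp only [Finset.mem_sigma, Finset.mem_filter, mem_divergingForests, Finset.mem_univ,
      true_and] at hx ⊢
    exact ⟨hx.1.1.insert_arc hx.1.2 hx.2, fun h => (isRoot_insert_iff.1 h).2 rfl⟩
  · rintro ⟨H, k⟩ hx ⟨H', k'⟩ hx' he
    simp only [Finset.mem_sigma, Finset.mem_filter, Finset.mem_univ, true_and] at hx hx' he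
    have hkk : k = k' := by
      have : (k, i) ∈ insert (k', i) H' := he ▸ Finset.mem_insert_self _ _
      rcases Finset.mem_insert.1 this with h | h
      · exact (Prod.mk.inj h).1
      · exact absurd h (hx'.1.2 k)
    subst hkk
    have hH : H = H' := by
      rw [← Finset.erase_insert (hx.1.2 k), ← Finset.erase_insert (hx'.1.2 k), he]
    subst hH
    rfl
  · intro F hF
    simp only [Finset.mem_filter, mem_divergingForests, IsRoot, not_forall, not_not] at hF
    obtain ⟨hF, k, hk⟩ := hF
    refine ⟨⟨F.erase (k, i), k⟩, ?_, Finset.insert_erase hk⟩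
    simp only [Finset.mem_sigma, Finset.mem_filter, mem_divergingForests, Finset.mem_univ,
      true_and]
    -- The deleted arc was the only one entering `i`, so `i` becomes a root; were `k` in its tree,
    -- restoring the arc would close a circuit.
    refine ⟨⟨hF.subset (Finset.erase_subset _ _), fun a ha => ?_⟩, fun h => ?_⟩
    · obtain ⟨hne, ha⟩ := Finset.mem_erase.1 ha
      exact hne (by rw [hF.2 a k i ha hk])
    · exact hF.1 i (.tail' (Relation.ReflTransGen.mono
        (fun _ _ he => Finset.mem_of_mem_erase he) _ _ h) hk)

open Classical in
/-- The indicator of the event that `i` is a root of `F` and `j` belongs to its tree. -/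
noncomputable def rootIndicator (F : Finset (Fin n × Fin n)) (i j : Fin n) : ℝ :=
  if IsRoot F i ∧ ForestReach F i j then 1 else 0

theorem rootIndicator_nonneg (F : Finset (Fin n × Fin n)) (i j : Fin n) :
    0 ≤ rootIndicator F i j := by
  unfold rootIndicator; split_ifs <;> norm_num

theorem rootIndicator_insert_self (k i x : Fin n) :
    rootIndicator (insert (k, i) F) i x = 0 := by
  simp [rootIndicator, isRoot_insert_iff]

theorem rootIndicator_mul_of_ne (hF : IsDivergingForest F) {i j : Fin n} (hij : i ≠ j)
    (x : Fin n) : rootIndicator F i x * rootIndicator F j x = 0 := by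
  unfold rootIndicator
  split_ifs with h₁ h₂
  · exact absurd (hF.root_unique h₁.1 h₂.1 h₁.2 h₂.2) hij
  all_goals simp

/-- The new arc hangs the whole tree of `i` at `k`, so the tree of `j` absorbs it exactly when it
contains `k`. The trees of `i` and `j` are disjoint, hence the indicators add. -/
theorem rootIndicator_insert_of_ne (hF : IsDivergingForest F) {i j : Fin n} (hi : IsRoot F i)
    (hij : j ≠ i) (k x : Fin n) :
    rootIndicator (insert (k, i) F) j x =
      rootIndicator F j x + rootIndicator F j k * rootIndicator F i x := by
  by_cases hj : IsRoot F j
  · have hx : (IsRoot (insert (k, i) F) j ∧ ForestReach (insert (k, i) F) j x) ↔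
        ForestReach F j x ∨ (ForestReach F j k ∧ ForestReach F i x) := by
      rw [isRoot_insert_iff, forestReach_insert_iff]
      tauto
    have h : ¬ (ForestReach F j x ∧ ForestReach F i x) := fun h =>
      hij (hF.root_unique hj hi h.1 h.2)
    simp only [rootIndicator, hx, hi, hj, true_and]
    by_cases h₁ : ForestReach F j x <;> by_cases h₂ : ForestReach F i x <;>
      by_cases h₃ : ForestReach F j k <;> simp_all
  · simp [rootIndicator, isRoot_insert_iff, hj]

end Forest

/-! ### Forest sums, the matrix forest theorem and the resolvent identity. -/

section ForestSum

/-- The product of the weights of the arcs of `F`. -/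
noncomputable def arcProd (w : Fin n → Fin n → ℝ) (F : Finset (Fin n × Fin n)) : ℝ :=
  ∏ e ∈ F, w e.1 e.2

/-- The total weight of all diverging forests. -/
noncomputable def forestSum (w : Fin n → Fin n → ℝ) : ℝ :=
  ∑ F ∈ divergingForests n, arcProd w F

/-- The total weight of the diverging forests in which `j` belongs to a tree with root `i`. -/
noncomputable def treeSum (w : Fin n → Fin n → ℝ) (i j : Fin n) : ℝ :=
  ∑ F ∈ divergingForests n, arcProd w F * rootIndicator F i j

/-- The relative weight of the diverging forests in which `j` belongs to a tree with root `i`. -/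
noncomputable def forestAccessibility (w : Fin n → Fin n → ℝ) (i j : Fin n) : ℝ :=
  treeSum w i j / forestSum w

variable {w : Fin n → Fin n → ℝ}

theorem arcProd_nonneg (hw : ∀ i j, 0 ≤ w i j) (F : Finset (Fin n × Fin n)) :
    0 ≤ arcProd w F :=
  Finset.prod_nonneg fun _ _ => hw _ _

theorem isDivergingForest_empty : IsDivergingForest (∅ : Finset (Fin n × Fin n)) := by
  refine ⟨fun a ha => ?_, by simp⟩
  obtain ⟨_, h, _⟩ := Relation.TransGen.head'_iff.1 ha
  simp at h

theorem forestSum_pos (hw : ∀ i j, 0 ≤ w i j) : 0 < forestSum w :=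
  Finset.sum_pos' (fun F _ => arcProd_nonneg hw F)
    ⟨∅, mem_divergingForests.2 isDivergingForest_empty, by simp [arcProd]⟩

theorem treeSum_nonneg (hw : ∀ i j, 0 ≤ w i j) (i j : Fin n) : 0 ≤ treeSum w i j :=
  Finset.sum_nonneg fun F _ => mul_nonneg (arcProd_nonneg hw F) (rootIndicator_nonneg F i j)

theorem forestAccessibility_nonneg (hw : ∀ i j, 0 ≤ w i j) (i j : Fin n) :
    0 ≤ forestAccessibility w i j :=
  div_nonneg (treeSum_nonneg hw i j) (forestSum_pos hw).le

theorem forestAccessibility_le (hw : ∀ i j, 0 ≤ w i j) {i j k : Fin n}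
    (h : ∀ F, IsDivergingForest F → (∀ a b, (a, b) ∈ F → 0 < w a b) → IsRoot F i →
      ForestReach F i j → ForestReach F i k) :
    forestAccessibility w i j ≤ forestAccessibility w i k := by
  refine div_le_div_of_nonneg_right (Finset.sum_le_sum fun F hF => ?_) (forestSum_pos hw).le
  by_cases hpos : ∀ a b, (a, b) ∈ F → 0 < w a b
  · refine mul_le_mul_of_nonneg_left ?_ (arcProd_nonneg hw F)
    by_cases hij : IsRoot F i ∧ ForestReach F i j
    · have := h F (mem_divergingForests.1 hF) hpos hij.1 hij.2
      simp [rootIndicator, hij.1, hij.2, this]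
    · rw [rootIndicator, if_neg hij]
      exact rootIndicator_nonneg F i k
  -- A forest using a non-arc has weight zero and does not affect the comparison.
  · push Not at hpos
    obtain ⟨a, b, hab, h₀⟩ := hpos
    have : arcProd w F = 0 := Finset.prod_eq_zero hab (le_antisymm h₀ (hw a b))
    simp [this]

-- The factor `1 - rootIndicator H i k` encodes that `k` lies outside the tree of `i`, so the inner
-- sum can run over all vertices and stays linear in the indicators.
open Classical in
theorem sum_arcProd_mul (w : Fin n → Fin n → ℝ) (i : Fin n)
    (g : Finset (Fin n × Fin n) → ℝ) :
    ∑ F ∈ divergingForests n, arcProd w F * g F =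
      ∑ H ∈ (divergingForests n).filter (IsRoot · i), arcProd w H *
        (g H + ∑ k, w k i * (1 - rootIndicator H i k) * g (insert (k, i) H)) := by
  rw [sum_divergingForests i]
  refine Finset.sum_congr rfl fun H hH => ?_
  have hi : IsRoot H i := (Finset.mem_filter.1 hH).2
  rw [mul_add, Finset.mul_sum, Finset.sum_filter]
  congr 1
  refine Finset.sum_congr rfl fun k _ => ?_
  by_cases hk : ForestReach H i k
  · simp [rootIndicator, hk, hi]
  · simp [rootIndicator, hk, arcProd, Finset.prod_insert (hi k)]
    ring

open Classical in
theorem forestSum_eq (w : Fin n → Fin n → ℝ) (i : Fin n) :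
    forestSum w = ∑ H ∈ (divergingForests n).filter (IsRoot · i), arcProd w H *
      (1 + ∑ k, w k i - ∑ k, w k i * rootIndicator H i k) := by
  have := sum_arcProd_mul w i fun _ => 1
  simp only [mul_one, mul_sub, Finset.sum_sub_distrib] at this
  rw [forestSum, this]
  exact Finset.sum_congr rfl fun H _ => by ring

open Classical in
theorem treeSum_self_eq (w : Fin n → Fin n → ℝ) (i x : Fin n) :
    treeSum w i x = ∑ H ∈ (divergingForests n).filter (IsRoot · i),
      arcProd w H * rootIndicator H i x := by
  rw [treeSum, sum_arcProd_mul w i]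
  simp [rootIndicator_insert_self]

open Classical in
theorem treeSum_eq_of_ne (w : Fin n → Fin n → ℝ) {i j : Fin n} (hij : j ≠ i) (x : Fin n) :
    treeSum w j x = ∑ H ∈ (divergingForests n).filter (IsRoot · i), arcProd w H *
      (rootIndicator H j x * (1 + ∑ k, w k i - ∑ k, w k i * rootIndicator H i k) +
        rootIndicator H i x * ∑ k, w k i * rootIndicator H j k) := by
  rw [treeSum, sum_arcProd_mul w i]
  refine Finset.sum_congr rfl fun H hH => ?_
  obtain ⟨hH, hi⟩ := Finset.mem_filter.1 hH
  rw [mem_divergingForests] at hH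
  have : ∀ k, w k i * (1 - rootIndicator H i k) * rootIndicator (insert (k, i) H) j x =
      rootIndicator H j x * (w k i - w k i * rootIndicator H i k) +
        rootIndicator H i x * (w k i * rootIndicator H j k) := fun k => by
    rw [rootIndicator_insert_of_ne hH hi hij]
    -- No `k` lies in both trees, so the product of the two indicators at `k` drops out.
    linear_combination -(w k i * rootIndicator H i x) * rootIndicator_mul_of_ne hH hij k
  simp only [this, Finset.sum_add_distrib, ← Finset.mul_sum, Finset.sum_sub_distrib]
  ring

/-- The matrix forest theorem, entrywise. -/
theorem treeSum_laplacian (w : Fin n → Fin n → ℝ) (i j : Fin n) :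
    treeSum w j i * (1 + ∑ k, w k i) - ∑ k, w k i * treeSum w j k =
      if i = j then forestSum w else 0 := by
  classical
  split_ifs with hij
  · subst hij
    simp only [treeSum_self_eq, forestSum_eq w i, Finset.mul_sum, Finset.sum_mul]
    rw [Finset.sum_comm, ← Finset.sum_sub_distrib]
    refine Finset.sum_congr rfl fun H hH => ?_
    have h1 : rootIndicator H i i = 1 := by
      simp only [rootIndicator, (Finset.mem_filter.1 hH).2, true_and]
      exact if_pos .refl
    rw [h1, mul_sub, Finset.mul_sum]
    congr 1
    · ring
    · exact Finset.sum_congr rfl fun k _ => by ring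
  · simp only [treeSum_eq_of_ne w (Ne.symm hij), Finset.mul_sum, Finset.sum_mul]
    rw [Finset.sum_comm (s := Finset.univ), ← Finset.sum_sub_distrib]
    refine Finset.sum_eq_zero fun H hH => ?_
    obtain ⟨hH, hi⟩ := Finset.mem_filter.1 hH
    rw [mem_divergingForests] at hH
    have h1 : rootIndicator H i i = 1 := by
      simp only [rootIndicator, hi, true_and]
      exact if_pos .refl
    have h0 : rootIndicator H j i = 0 := by
      have := rootIndicator_mul_of_ne hH hij i
      rwa [h1, one_mul] at this
    rw [h1, h0]
    simp only [← Finset.mul_sum]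
    set S := ∑ k, w k i
    set A := ∑ k, w k i * rootIndicator H i k with hA
    set B := ∑ k, w k i * rootIndicator H j k with hB
    -- The terms in A * B cancel, leaving B * (1 + S), which is also what the diagonal term
    -- contributes: the identity holds forest by forest.
    have : ∑ k, w k i * (arcProd w H * (rootIndicator H j k * (1 + S - A) +
        rootIndicator H i k * B)) = arcProd w H * (B * (1 + S - A) + A * B) := by
      rw [hA, hB, Finset.sum_mul, Finset.sum_mul, ← Finset.sum_add_distrib, Finset.mul_sum]
      exact Finset.sum_congr rfl fun k _ => by ring
    rw [this]
    ring

theorem forestAccessibility_laplacian (hw : forestSum w ≠ 0) (i j : Fin n) :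
    forestAccessibility w j i * (1 + ∑ k, w k i) - ∑ k, w k i * forestAccessibility w j k =
      if i = j then 1 else 0 := by
  have h := treeSum_laplacian w i j
  simp only [forestAccessibility, ← mul_div_assoc, ← Finset.sum_div]
  rw [div_mul_eq_mul_div, ← sub_div, h]
  split_ifs <;> simp [hw]

/-- The identity matrix plus the Laplacian matrix. -/
noncomputable def shiftedLaplacian (w : Fin n → Fin n → ℝ) : Matrix (Fin n) (Fin n) ℝ :=
  Matrix.of fun i x => (if i = x then 1 + ∑ k, w k i else 0) - w x i

theorem shiftedLaplacian_mul_apply (w : Fin n → Fin n → ℝ) (Q : Matrix (Fin n) (Fin n) ℝ)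
    (i j : Fin n) : (shiftedLaplacian w * Q) i j =
      Q i j * (1 + ∑ k, w k i) - ∑ k, w k i * Q k j := by
  simp [shiftedLaplacian, Matrix.mul_apply, sub_mul, mul_comm (Q i j)]

theorem shiftedLaplacian_mul_forestAccessibility (hw : forestSum w ≠ 0) :
    shiftedLaplacian w * (Matrix.of (forestAccessibility w)).transpose = 1 := by
  ext i j
  rw [shiftedLaplacian_mul_apply, Matrix.one_apply]
  exact forestAccessibility_laplacian hw i j

/-- The resolvent identity for a change of the weight of one arc. -/
theorem forestAccessibility_sub {w' : Fin n → Fin n → ℝ} (hw : forestSum w ≠ 0)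
    (hw' : forestSum w' ≠ 0) {k t : Fin n} {δ : ℝ} (hkt : w' k t = w k t + δ)
    (h : ∀ i j, (i, j) ≠ (k, t) → w' i j = w i j) (b a : Fin n) :
    forestAccessibility w' b a - forestAccessibility w b a =
      δ * forestAccessibility w t a *
        (forestAccessibility w' b k - forestAccessibility w' b t) := by
  set Q := (Matrix.of (forestAccessibility w)).transpose with hQ
  set Q' := (Matrix.of (forestAccessibility w')).transpose with hQ'
  have hw_eq : ∀ x i, w x i = w' x i - if i = t then (if x = k then δ else 0) else 0 := by
    intro x i
    by_cases hi : i = t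
    · by_cases hx : x = k
      · subst hi hx; simp [hkt]
      · simp [hi, hx, h x t (by simp [hx])]
    · simp [hi, h x i (by simp [hi])]
  -- Only row `t` of the shifted Laplacian involves the weight of `(k, t)`, so its product with `Q'`
  -- differs from the identity in that row alone. Multiplying on the left by `Q` then gives the
  -- claim.
  have key : ∀ x, (shiftedLaplacian w * Q') x b =
      (if x = b then 1 else 0) + if x = t then δ * (Q' k b - Q' t b) else 0 := by
    intro x
    have h₁ := forestAccessibility_laplacian hw' x b
    rw [shiftedLaplacian_mul_apply, ← h₁]
    simp only [hw_eq, sub_mul, Finset.sum_sub_distrib]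
    by_cases hx : x = t
    · simp [hx, hQ']
      ring
    · simp [hx, hQ']
  have h₁ : Q * shiftedLaplacian w = 1 :=
    mul_eq_one_comm.1 (shiftedLaplacian_mul_forestAccessibility hw)
  have h₂ : Q' a b = (Q * (shiftedLaplacian w * Q')) a b := by
    rw [← Matrix.mul_assoc, h₁, Matrix.one_mul]
  rw [Matrix.mul_apply] at h₂
  simp only [key, mul_add, Finset.sum_add_distrib, mul_ite, mul_one, mul_zero,
    Finset.sum_ite_eq', Finset.mem_univ, if_true] at h₂
  simp only [hQ, hQ', Matrix.transpose_apply, Matrix.of_apply] at h₂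
  rw [h₂]
  ring

end ForestSum

/-! ### Passage to the limit τ → ∞. -/

section Limit

open Filter Topology

theorem arcProd_smul (τ : ℝ) (w : Fin n → Fin n → ℝ) (F : Finset (Fin n × Fin n)) :
    arcProd (τ • w) F = τ ^ F.card * arcProd w F := by
  simp [arcProd, Finset.prod_mul_distrib]

variable (G : WeightedDigraph n)

theorem mem_forests {F : Finset (Fin n × Fin n)} :
    F ∈ G.forests ↔ (∀ a b, (a, b) ∈ F → G.Arc a b) ∧ IsDivergingForest F := by
  simp [forests, arcs, Finset.subset_iff]

theorem mem_maxForests {F : Finset (Fin n × Fin n)} :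
    F ∈ G.maxForests ↔ F ∈ G.forests ∧ ∀ F' ∈ G.forests, F'.card ≤ F.card := by
  simp [maxForests]

theorem exists_mem_maxForests : ∃ F, F ∈ G.maxForests := by
  obtain ⟨F, hF, hmax⟩ := Finset.exists_max_image G.forests Finset.card
    ⟨∅, G.mem_forests.2 ⟨by simp, isDivergingForest_empty⟩⟩
  exact ⟨F, G.mem_maxForests.2 ⟨hF, hmax⟩⟩

theorem arcProd_eq_zero_of_notMem_forests {F : Finset (Fin n × Fin n)}
    (hF : IsDivergingForest F) (h : F ∉ G.forests) : arcProd G.weight F = 0 := by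
  rw [mem_forests] at h
  simp only [hF, and_true, not_forall] at h
  obtain ⟨a, b, hab, h⟩ := h
  exact Finset.prod_eq_zero hab (le_antisymm (not_lt.1 h) (G.weight_nonneg a b))

theorem arcProd_pos {F : Finset (Fin n × Fin n)} (h : F ∈ G.forests) : 0 < arcProd G.weight F :=
  Finset.prod_pos fun e he => (G.mem_forests.1 h).1 e.1 e.2 he

theorem setWeight_nonneg (S : Finset (Finset (Fin n × Fin n))) : 0 ≤ G.setWeight S :=
  Finset.sum_nonneg fun F _ => arcProd_nonneg G.weight_nonneg F

theorem setWeight_maxForests_pos : 0 < G.setWeight G.maxForests := by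
  obtain ⟨F, hF⟩ := G.exists_mem_maxForests
  exact Finset.sum_pos' (fun F _ => arcProd_nonneg G.weight_nonneg F)
    ⟨F, hF, G.arcProd_pos (G.mem_maxForests.1 hF).1⟩

-- Scaling multiplies the weight of `F` by τ^|F|. After division by the top power, maximum forests
-- keep their weight and smaller ones tend to zero.
open Classical in
theorem tendsto_sum_arcProd_div_pow {F₀ : Finset (Fin n × Fin n)} (hF₀ : F₀ ∈ G.maxForests)
    (g : Finset (Fin n × Fin n) → ℝ) :
    Tendsto (fun τ : ℝ => (∑ F ∈ divergingForests n, arcProd (τ • G.weight) F * g F) /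
      τ ^ F₀.card) atTop (𝓝 (∑ F ∈ G.maxForests, arcProd G.weight F * g F)) := by
  have hsub : G.maxForests = (divergingForests n).filter (· ∈ G.maxForests) := by
    ext F
    simp only [Finset.mem_filter, mem_divergingForests, iff_and_self]
    exact fun h => (G.mem_forests.1 (G.mem_maxForests.1 h).1).2
  rw [hsub, Finset.sum_filter]
  simp only [Finset.sum_div]
  refine tendsto_finsetSum _ fun F hF => ?_
  rw [mem_divergingForests] at hF
  obtain ⟨hF₀, hmax₀⟩ := G.mem_maxForests.1 hF₀
  by_cases hFmax : F ∈ G.maxForests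
  · rw [if_pos hFmax]
    obtain ⟨hFG, hmax⟩ := G.mem_maxForests.1 hFmax
    have hcard : F.card = F₀.card := le_antisymm (hmax₀ F hFG) (hmax F₀ hF₀)
    refine tendsto_const_nhds.congr' ?_
    filter_upwards [eventually_gt_atTop 0] with τ hτ
    rw [arcProd_smul, hcard]
    field_simp
  · rw [if_neg hFmax]
    by_cases hFG : F ∈ G.forests
    · have hlt : F.card < F₀.card := by
        by_contra hle
        exact hFmax (G.mem_maxForests.2 ⟨hFG, fun F' hF' => (hmax₀ F' hF').trans (not_lt.1 hle)⟩)
      have h₁ : Tendsto (fun τ : ℝ => τ ^ F.card / τ ^ F₀.card) atTop (𝓝 0) :=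
        tendsto_pow_div_pow_atTop_zero hlt
      have h₂ := h₁.mul_const (arcProd G.weight F * g F)
      rw [zero_mul] at h₂
      refine h₂.congr fun τ => ?_
      rw [arcProd_smul]
      ring
    · simp [arcProd_smul, G.arcProd_eq_zero_of_notMem_forests hF hFG]

theorem limitingAccessibility_apply (i j : Fin n) :
    limitingAccessibility n G i j =
      G.setWeight (G.maxForestsFrom i j) / G.setWeight G.maxForests := rfl

theorem setWeight_maxForestsFrom (i j : Fin n) :
    G.setWeight (G.maxForestsFrom i j) =
      ∑ F ∈ G.maxForests, arcProd G.weight F * rootIndicator F i j := by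
  rw [setWeight, maxForestsFrom, Finset.sum_filter]
  refine Finset.sum_congr rfl fun F _ => ?_
  unfold rootIndicator arcProd
  split_ifs <;> simp

theorem tendsto_forestAccessibility (i j : Fin n) :
    Tendsto (fun τ : ℝ => forestAccessibility (τ • G.weight) i j) atTop
      (𝓝 (limitingAccessibility n G i j)) := by
  obtain ⟨F₀, hF₀⟩ := G.exists_mem_maxForests
  have h₁ := G.tendsto_sum_arcProd_div_pow hF₀ fun F => rootIndicator F i j
  have h₂ := G.tendsto_sum_arcProd_div_pow hF₀ fun _ => 1
  simp only [mul_one] at h₂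
  rw [← setWeight_maxForestsFrom] at h₁
  refine (h₁.div h₂ G.setWeight_maxForests_pos.ne').congr' ?_
  filter_upwards [eventually_gt_atTop 0] with τ hτ
  exact div_div_div_cancel_right₀ (by positivity) _ _

end Limit

/-! ### Inequalities at finite τ and their limits. -/

section Conditions

variable (G : WeightedDigraph n)

theorem smul_weight_nonneg {τ : ℝ} (hτ : 0 ≤ τ) (i j : Fin n) : 0 ≤ (τ • G.weight) i j :=
  mul_nonneg hτ (G.weight_nonneg i j)

theorem arc_of_smul_weight_pos {τ : ℝ} (hτ : 0 ≤ τ) {a b : Fin n}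
    (h : 0 < (τ • G.weight) a b) : G.Arc a b :=
  pos_of_mul_pos_right h hτ

theorem forestAccessibility_smul_le {τ : ℝ} (hτ : 0 ≤ τ) {i j k : Fin n}
    (h : ∀ F ∈ G.forests, IsRoot F i → ForestReach F i j → ForestReach F i k) :
    forestAccessibility (τ • G.weight) i j ≤ forestAccessibility (τ • G.weight) i k :=
  forestAccessibility_le (G.smul_weight_nonneg hτ) fun F hF hpos =>
    h F (G.mem_forests.2 ⟨fun a b hab => G.arc_of_smul_weight_pos hτ (hpos a b hab), hF⟩)

theorem limitingAccessibility_le {i j k : Fin n}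
    (h : ∀ F ∈ G.forests, IsRoot F i → ForestReach F i j → ForestReach F i k) :
    limitingAccessibility n G i j ≤ limitingAccessibility n G i k := by
  refine le_of_tendsto_of_tendsto (G.tendsto_forestAccessibility i j)
    (G.tendsto_forestAccessibility i k) ?_
  filter_upwards [Filter.eventually_ge_atTop 0] with τ hτ
  exact G.forestAccessibility_smul_le hτ h

theorem forestReach_of_forall_isPath {i k t : Fin n} (h : ∀ l, G.IsPath i t l → k ∈ l)
    {F : Finset (Fin n × Fin n)} (hF : F ∈ G.forests) (hit : ForestReach F i t) :
    ForestReach F i k := by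
  obtain ⟨hFG, hF⟩ := G.mem_forests.1 hF
  obtain ⟨l, hchain, hlast⟩ := List.exists_isChain_cons_of_relationReflTransGen hit
  -- Along a walk in `F` each vertex reaches every later one by at least one arc; a repeated vertex
  -- would give a circuit, so the walk is a path of `G`.
  have hpw : (i :: l).Pairwise (Relation.TransGen fun a b => (a, b) ∈ F) :=
    List.isChain_iff_pairwise.1 (hchain.imp fun _ _ hab => .single hab)
  have hnodup : (i :: l).Nodup := hpw.imp fun {a b} hab => by
    rintro rfl
    exact hF.1 _ hab
  have hk : k ∈ i :: l := h (i :: l) ⟨rfl, by rw [List.getLast?_eq_some_getLast (by simp), hlast],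
    hchain.imp hFG, hnodup⟩
  rcases List.mem_cons.1 hk with rfl | hk
  · exact .refl
  · exact (List.rel_of_pairwise_cons hpw hk).to_reflTransGen

variable {G} {G' : WeightedDigraph n} {k t : Fin n}

theorem IsArcIncrease.arc_iff (h : G.IsArcIncrease G' k t) (i j : Fin n) :
    G'.Arc i j ↔ G.Arc i j := by
  by_cases hij : (i, j) = (k, t)
  · obtain ⟨rfl, rfl⟩ := Prod.mk.inj hij
    exact iff_of_true (lt_trans h.1 h.2.1) h.1
  · rw [Arc, Arc, h.2.2 i j hij]

theorem IsArcIncrease.forests_eq (h : G.IsArcIncrease G' k t) : G'.forests = G.forests := by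
  ext F
  simp [mem_forests, h.arc_iff]

theorem IsArcIncrease.forestAccessibility_sub (h : G.IsArcIncrease G' k t) {τ : ℝ} (hτ : 0 ≤ τ)
    (i j : Fin n) :
    forestAccessibility (τ • G'.weight) i j - forestAccessibility (τ • G.weight) i j =
      τ * (G'.weight k t - G.weight k t) * forestAccessibility (τ • G.weight) t j *
        (forestAccessibility (τ • G'.weight) i k - forestAccessibility (τ • G'.weight) i t) := by
  refine WeightedDigraph.forestAccessibility_sub (forestSum_pos (G.smul_weight_nonneg hτ)).ne'
    (forestSum_pos (G'.smul_weight_nonneg hτ)).ne' ?_ (fun a b hab => ?_) i j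
  · simp only [Pi.smul_apply, smul_eq_mul]
    ring
  · simp [h.2.2 a b hab]

/-- In the resolvent identity for the entry `(k, t)` every factor is nonnegative, the last one by
diagonal maximality. -/
theorem IsArcIncrease.limitingAccessibility_le (h : G.IsArcIncrease G' k t) :
    limitingAccessibility n G k t ≤ limitingAccessibility n G' k t := by
  refine le_of_tendsto_of_tendsto (G.tendsto_forestAccessibility k t)
    (G'.tendsto_forestAccessibility k t) ?_
  filter_upwards [Filter.eventually_ge_atTop 0] with τ hτ
  rw [← sub_nonneg, h.forestAccessibility_sub hτ]
  have h₁ := forestAccessibility_nonneg (G.smul_weight_nonneg hτ) t t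
  have h₂ : forestAccessibility (τ • G'.weight) k t ≤ forestAccessibility (τ • G'.weight) k k :=
    G'.forestAccessibility_smul_le hτ fun _ _ _ _ => .refl
  exact mul_nonneg (mul_nonneg (mul_nonneg hτ (sub_nonneg.2 h.2.1.le)) h₁) (sub_nonneg.2 h₂)

/-- By the resolvent identity the two changes share all factors but one: the accessibility from `t`
to `t` or to `k`. Diagonal maximality compares these, and the transit inequality makes the common
factor nonnegative. It is needed for `G'`, which has the same forests as `G`. -/
theorem IsArcIncrease.limitingAccessibility_sub_le (h : G.IsArcIncrease G' k t) {i : Fin n}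
    (hi : ∀ l, G.IsPath i t l → k ∈ l) :
    limitingAccessibility n G' i k - limitingAccessibility n G i k ≤
      limitingAccessibility n G' i t - limitingAccessibility n G i t := by
  refine le_of_tendsto_of_tendsto
    ((G'.tendsto_forestAccessibility i k).sub (G.tendsto_forestAccessibility i k))
    ((G'.tendsto_forestAccessibility i t).sub (G.tendsto_forestAccessibility i t)) ?_
  filter_upwards [Filter.eventually_ge_atTop 0] with τ hτ
  simp only [h.forestAccessibility_sub hτ]
  have h₁ : forestAccessibility (τ • G.weight) t k ≤ forestAccessibility (τ • G.weight) t t :=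
    G.forestAccessibility_smul_le hτ fun _ _ _ _ => .refl
  have h₂ : forestAccessibility (τ • G'.weight) i t ≤ forestAccessibility (τ • G'.weight) i k :=
    G'.forestAccessibility_smul_le hτ fun F hF _ =>
      G.forestReach_of_forall_isPath hi (h.forests_eq ▸ hF)
  exact mul_le_mul_of_nonneg_right
    (mul_le_mul_of_nonneg_left h₁ (mul_nonneg hτ (sub_nonneg.2 h.2.1.le))) (sub_nonneg.2 h₂)

theorem limitingAccessibility_eq_zero_of_forall (i j : Fin n)
    (h : ∀ F ∈ G.maxForests, IsRoot F i → ¬ ForestReach F i j) :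
    limitingAccessibility n G i j = 0 := by
  rw [limitingAccessibility_apply, setWeight_maxForestsFrom, Finset.sum_eq_zero, zero_div]
  intro F hF
  rw [rootIndicator, if_neg fun hij => h F hF hij.1 hij.2, mul_zero]

end Conditions

/-! ### The directed path and the fork. -/

section Examples

variable {n : ℕ}

theorem isDivergingForest_of_lt {F : Finset (Fin n × Fin n)} (hlt : ∀ a b, (a, b) ∈ F → a < b)
    (hdeg : ∀ a b c, (a, c) ∈ F → (b, c) ∈ F → a = b) : IsDivergingForest F := by
  refine ⟨fun a ha => lt_irrefl a ?_, hdeg⟩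
  have : ∀ b, Relation.TransGen (fun x y => (x, y) ∈ F) a b → a < b := fun b hb => by
    induction hb with
    | single h => exact hlt _ _ h
    | tail _ h ih => exact ih.trans (hlt _ _ h)
  exact this a ha

theorem maxForests_eq_singleton (G : WeightedDigraph n) (h : IsDivergingForest G.arcs) :
    G.maxForests = {G.arcs} := by
  have harcs : G.arcs ∈ G.forests := G.mem_forests.2 ⟨by simp [arcs], h⟩
  have hsub : ∀ F ∈ G.forests, F ⊆ G.arcs := fun F hF => by
    simp only [forests, Finset.mem_filter, Finset.mem_powerset] at hF
    exact hF.1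
  ext F
  rw [mem_maxForests, Finset.mem_singleton]
  constructor
  · rintro ⟨hF, hmax⟩
    exact Finset.eq_of_subset_of_card_le (hsub F hF) (hmax _ harcs)
  · rintro rfl
    exact ⟨harcs, fun F hF => Finset.card_le_card (hsub F hF)⟩

/-- The only maximum forest is the digraph itself, so its weight cancels. -/
theorem limitingAccessibility_eq_rootIndicator (G : WeightedDigraph n)
    (h : IsDivergingForest G.arcs) (i j : Fin n) :
    limitingAccessibility n G i j = rootIndicator G.arcs i j := by
  have hpos : arcProd G.weight G.arcs ≠ 0 := (G.arcProd_pos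
    (G.mem_forests.2 ⟨by simp [arcs], h⟩)).ne'
  rw [limitingAccessibility_apply, setWeight_maxForestsFrom, setWeight,
    G.maxForests_eq_singleton h, Finset.sum_singleton, Finset.sum_singleton]
  exact mul_div_cancel_left₀ _ hpos

/-- The directed path `0 → 1 → ⋯ → n`, all arcs having weight `c`. -/
noncomputable def pathDigraph (n : ℕ) (c : ℝ) (hc : 0 < c) : WeightedDigraph (n + 1) where
  weight i j := if (i : ℕ) + 1 = j then c else 0
  weight_nonneg i j := by split_ifs <;> simp [hc.le]
  weight_self i := by simp

variable {c : ℝ} {hc : 0 < c}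

theorem pathDigraph_arc {i j : Fin (n + 1)} :
    (pathDigraph n c hc).Arc i j ↔ (i : ℕ) + 1 = j := by
  unfold Arc pathDigraph
  dsimp only
  split_ifs with h <;> simp [h, hc]

theorem isDivergingForest_arcs_pathDigraph : IsDivergingForest (pathDigraph n c hc).arcs := by
  refine isDivergingForest_of_lt (fun a b h => ?_) (fun a b d ha hb => ?_)
  · simp only [arcs, Finset.mem_filter, Finset.mem_univ, true_and, pathDigraph_arc] at h
    exact Fin.lt_def.2 (by omega)
  · simp only [arcs, Finset.mem_filter, Finset.mem_univ, true_and, pathDigraph_arc] at ha hb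
    exact Fin.ext (by omega)

theorem limitingAccessibility_pathDigraph_zero (j : Fin (n + 1)) :
    limitingAccessibility (n + 1) (pathDigraph n c hc) 0 j = 1 := by
  rw [limitingAccessibility_eq_rootIndicator _ isDivergingForest_arcs_pathDigraph, rootIndicator,
    if_pos]
  refine ⟨fun a h => ?_, ?_⟩
  · simp [arcs, pathDigraph_arc] at h
  · induction j using Fin.induction with
    | zero => exact .refl
    | succ i ih => exact ih.tail (by simp [arcs, pathDigraph_arc])

theorem limitingAccessibility_pathDigraph_succ (i : Fin n) (j : Fin (n + 1)) :
    limitingAccessibility (n + 1) (pathDigraph n c hc) i.succ j = 0 := by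
  rw [limitingAccessibility_eq_rootIndicator _ isDivergingForest_arcs_pathDigraph, rootIndicator,
    if_neg]
  exact fun h => h.1 i.castSucc (by simp [arcs, pathDigraph_arc])

theorem isPath_pathDigraph : (pathDigraph 2 c hc).IsPath 0 1 [0, 1] := by
  simp [IsPath, pathDigraph_arc]

theorem mem_of_isPath_pathDigraph {l : List (Fin 3)}
    (hl : (pathDigraph 2 c hc).IsPath 0 2 l) : 1 ∈ l := by
  obtain ⟨h₁, h₂, h₃, -⟩ := hl
  match l, h₁, h₂, h₃ with
  | [a], h₁, h₂, _ => simp_all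
  | a :: b :: l, h₁, _, h₃ =>
    have h := pathDigraph_arc.1 (List.isChain_cons_cons.1 h₃).1
    obtain rfl : a = 0 := by simpa using h₁
    obtain rfl : b = 1 := Fin.ext h.symm
    simp

theorem isArcIncrease_pathDigraph {c' : ℝ} {hc' : 0 < c'} (h : c < c') :
    (pathDigraph 1 c hc).IsArcIncrease (pathDigraph 1 c' hc') 0 1 := by
  refine ⟨pathDigraph_arc.2 rfl, by simpa [pathDigraph] using h, fun i j hij => ?_⟩
  have : ¬ ((i : ℕ) + 1 = j) := fun h => hij (Prod.ext (Fin.ext (by simp; omega))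
    (Fin.ext (by simp; omega)))
  simp [pathDigraph, this]

/-- The digraph with arcs `0 → 1`, `1 → 3` and `2 → 3`, the second having weight `c` and the others
weight `1`. -/
noncomputable def forkDigraph (c : ℝ) (hc : 0 < c) : WeightedDigraph 4 where
  weight i j := if i = 1 ∧ j = 3 then c else if (i = 0 ∧ j = 1) ∨ (i = 2 ∧ j = 3) then 1 else 0
  weight_nonneg i j := by split_ifs <;> simp [hc.le]
  weight_self i := by fin_cases i <;> simp

theorem forkDigraph_arc {i j : Fin 4} : (forkDigraph c hc).Arc i j ↔
    (i = 1 ∧ j = 3) ∨ (i = 0 ∧ j = 1) ∨ (i = 2 ∧ j = 3) := by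
  unfold Arc forkDigraph
  dsimp only
  split_ifs with h₁ h₂
  · simp [h₁, hc]
  · simp [h₂]
  · simp [h₁, h₂]

theorem isDivergingForest_fork {k : Fin 4} (hk : k = 1 ∨ k = 2) :
    IsDivergingForest {((0 : Fin 4), (1 : Fin 4)), (k, 3)} := by
  refine isDivergingForest_of_lt (fun a b h => ?_) (fun a b d ha hb => ?_)
  · rcases hk with rfl | rfl <;> revert h <;> revert a b <;> decide
  · rcases hk with rfl | rfl <;> revert ha hb <;> revert a b d <;> decide

/-- Vertex 3 accepts only one of its two incoming arcs, while the arc from 0 to 1 conflicts with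
neither. -/
theorem maxForests_forkDigraph :
    (forkDigraph c hc).maxForests = {{(0, 1), (1, 3)}, {(0, 1), (2, 3)}} := by
  have hmem : ∀ k : Fin 4, k = 1 ∨ k = 2 →
      {((0 : Fin 4), (1 : Fin 4)), (k, 3)} ∈ (forkDigraph c hc).forests := fun k hk => by
    refine (mem_forests _).2 ⟨fun a b hab => ?_, isDivergingForest_fork hk⟩
    simp only [Finset.mem_insert, Finset.mem_singleton, Prod.mk.injEq] at hab
    rw [forkDigraph_arc]
    rcases hk with rfl | rfl <;> tauto
  have hcard : ∀ k : Fin 4, Finset.card {((0 : Fin 4), (1 : Fin 4)), (k, (3 : Fin 4))} = 2 := by decide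
  have hsub : ∀ F ∈ (forkDigraph c hc).forests,
      ∃ k : Fin 4, (k = 1 ∨ k = 2) ∧ F ⊆ {((0 : Fin 4), (1 : Fin 4)), (k, 3)} := by
    intro F hF
    obtain ⟨hFG, hF⟩ := (mem_forests _).1 hF
    by_cases h : ((1 : Fin 4), (3 : Fin 4)) ∈ F
    · refine ⟨1, Or.inl rfl, fun ⟨a, b⟩ hab => ?_⟩
      rcases forkDigraph_arc.1 (hFG a b hab) with ⟨rfl, rfl⟩ | ⟨rfl, rfl⟩ | ⟨rfl, rfl⟩
      · simp
      · simp
      · exact absurd (hF.2 _ _ _ h hab) (by decide)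
    · refine ⟨2, Or.inr rfl, fun ⟨a, b⟩ hab => ?_⟩
      rcases forkDigraph_arc.1 (hFG a b hab) with ⟨rfl, rfl⟩ | ⟨rfl, rfl⟩ | ⟨rfl, rfl⟩
      · exact absurd hab h
      · simp
      · simp
  ext F
  rw [mem_maxForests, Finset.mem_insert, Finset.mem_singleton]
  constructor
  · rintro ⟨hF, hmax⟩
    obtain ⟨k, hk, hFk⟩ := hsub F hF
    have := Finset.eq_of_subset_of_card_le hFk (hmax _ (hmem k hk))
    rcases hk with rfl | rfl
    · exact Or.inl this
    · exact Or.inr this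
  · have hmax : ∀ k : Fin 4, ∀ F ∈ (forkDigraph c hc).forests,
        F.card ≤ Finset.card {((0 : Fin 4), (1 : Fin 4)), (k, (3 : Fin 4))} := fun k F hF => by
      obtain ⟨k', -, hFk⟩ := hsub F hF
      exact (Finset.card_le_card hFk).trans (by rw [hcard, hcard])
    rintro (rfl | rfl)
    · exact ⟨hmem 1 (Or.inl rfl), hmax 1⟩
    · exact ⟨hmem 2 (Or.inr rfl), hmax 2⟩

theorem limitingAccessibility_forkDigraph_one_three :
    limitingAccessibility 4 (forkDigraph c hc) 1 3 = 0 := by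
  refine limitingAccessibility_eq_zero_of_forall 1 3 fun F hF hroot => ?_
  rw [maxForests_forkDigraph, Finset.mem_insert, Finset.mem_singleton] at hF
  exact absurd (by rcases hF with rfl | rfl <;> simp) (hroot 0)

/-- Of the two maximum forests, of weights `c` and 1, only the first joins 0 to 3; in the other, 3
has root 2. -/
theorem limitingAccessibility_forkDigraph_zero_three :
    limitingAccessibility 4 (forkDigraph c hc) 0 3 = c / (c + 1) := by
  have h₁ : rootIndicator {((0 : Fin 4), (1 : Fin 4)), (1, 3)} 0 3 = 1 := by
    rw [rootIndicator, if_pos]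
    exact ⟨by unfold IsRoot; decide,
      .head (b := 1) (by simp) (.single (by simp))⟩
  have h₂ : rootIndicator {((0 : Fin 4), (1 : Fin 4)), (2, 3)} 0 3 = 0 := by
    rw [rootIndicator, if_neg]
    rintro ⟨h0, h03⟩
    have := (isDivergingForest_fork (Or.inr rfl)).root_unique h0 (j := 2)
      (by unfold IsRoot; decide) h03 (.single (by simp))
    exact absurd this (by decide)
  have hne : ({(0, 1), (1, 3)} : Finset (Fin 4 × Fin 4)) ≠ {(0, 1), (2, 3)} := by decide
  rw [limitingAccessibility_apply, setWeight_maxForestsFrom, setWeight, maxForests_forkDigraph,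
    Finset.sum_pair hne, Finset.sum_pair hne, h₁, h₂]
  simp [arcProd, forkDigraph]

theorem isArcIncrease_forkDigraph {c' : ℝ} {hc' : 0 < c'} (h : c < c') :
    (forkDigraph c hc).IsArcIncrease (forkDigraph c' hc') 1 3 := by
  refine ⟨forkDigraph_arc.2 (by simp), by simpa [forkDigraph] using h, fun i j hij => ?_⟩
  have : ¬ (i = 1 ∧ j = 3) := fun h => hij (by rw [h.1, h.2])
  simp [forkDigraph, this]

end Examples

end WeightedDigraph

/-! ### Verdict on each condition. -/

namespace ProximityIndex

open WeightedDigraph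

theorem nonnegativity_limitingAccessibility : limitingAccessibility.Nonnegativity :=
  fun _ _ G _ _ => div_nonneg (G.setWeight_nonneg _) (G.setWeight_nonneg _)

theorem disconnectionBackward_limitingAccessibility :
    limitingAccessibility.DisconnectionBackward := by
  refine fun n _ G i j hij => limitingAccessibility_eq_zero_of_forall i j fun F hF _ h => hij ?_
  have hF := (G.mem_forests.1 (G.mem_maxForests.1 hF).1).1
  exact Relation.ReflTransGen.mono hF _ _ h

theorem diagonalMaximality_limitingAccessibility :
    limitingAccessibility.DiagonalMaximality (· ≥ ·) :=
  fun _ _ G _ _ _ => G.limitingAccessibility_le fun _ _ _ _ => .refl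

theorem not_diagonalMaximality_limitingAccessibility :
    ¬ limitingAccessibility.DiagonalMaximality (· > ·) := fun h => by
  have := h 2 one_lt_two (pathDigraph 1 1 one_pos) 0 1 (by decide)
  simp [limitingAccessibility_pathDigraph_zero] at this

theorem transit_limitingAccessibility : limitingAccessibility.Transit (· ≥ ·) :=
  fun _ _ G _ _ _ _ _ _ h =>
    G.limitingAccessibility_le fun _ hF _ => G.forestReach_of_forall_isPath h hF

theorem not_transit_limitingAccessibility : ¬ limitingAccessibility.Transit (· > ·) := fun h => by
  have := h 3 (by norm_num) (pathDigraph 2 1 one_pos) 0 1 2 ⟨_, isPath_pathDigraph⟩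
    (by decide) (by decide) fun _ => mem_of_isPath_pathDigraph
  simp [limitingAccessibility_pathDigraph_zero] at this

theorem monotonicityOneFirst_limitingAccessibility :
    limitingAccessibility.MonotonicityOneFirst (· ≥ ·) :=
  fun _ _ _ _ _ _ h => sub_nonneg.2 h.limitingAccessibility_le

theorem not_monotonicityOneFirst_limitingAccessibility :
    ¬ limitingAccessibility.MonotonicityOneFirst (· > ·) := fun h => by
  have := h 2 one_lt_two _ _ 0 1
    (isArcIncrease_pathDigraph (hc := one_pos) (hc' := two_pos) one_lt_two)
  simp [limitingAccessibility_pathDigraph_zero] at this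

theorem monotonicityTwo_limitingAccessibility : limitingAccessibility.MonotonicityTwo (· ≥ ·) :=
  fun _ _ _ _ _ _ h _ _ hi => h.limitingAccessibility_sub_le hi

/-- Here `i = k = 0`, with the one-vertex path; both changes are zero. -/
theorem not_monotonicityTwo_limitingAccessibility :
    ¬ limitingAccessibility.MonotonicityTwo (· > ·) := fun h => by
  have := h 2 one_lt_two _ _ 0 1
    (isArcIncrease_pathDigraph (hc := one_pos) (hc' := two_pos) one_lt_two) 0
    ⟨[0], by simp [IsPath]⟩ fun l hl => List.mem_of_mem_head? (hl.1 ▸ rfl)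
  simp [limitingAccessibility_pathDigraph_zero] at this

/-- The reversed digraph need not be computed: transposing the matrix of the path puts 1 beside the
diagonal entry 0, against diagonal maximality. -/
theorem not_reversal_limitingAccessibility : ¬ limitingAccessibility.Reversal := fun h => by
  set G := pathDigraph 1 1 one_pos
  have h₁ : limitingAccessibility 2 G.reverse 1 0 = limitingAccessibility 2 G 0 1 :=
    congrFun (congrFun (h 2 one_lt_two G) 1) 0
  have h₂ : limitingAccessibility 2 G.reverse 1 1 = limitingAccessibility 2 G 1 1 :=
    congrFun (congrFun (h 2 one_lt_two G) 1) 1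
  have h₃ : limitingAccessibility 2 G 1 1 = 0 := limitingAccessibility_pathDigraph_succ 0 1
  have h₄ : limitingAccessibility 2 G 0 1 = 1 := limitingAccessibility_pathDigraph_zero 1
  have h₅ := diagonalMaximality_limitingAccessibility 2 one_lt_two G.reverse 1 0 (by decide)
  rw [h₁, h₂, h₃, h₄] at h₅
  norm_num at h₅

/-- With `j = k = 1` the first conjunct would read 1 ≥ 1 + 1 - 0; it does not involve `r`. -/
theorem not_triangleInequality_limitingAccessibility (r : ℝ → ℝ → Prop) :
    ¬ limitingAccessibility.TriangleInequality r := fun h => by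
  have h₁ := (h 2 one_lt_two (pathDigraph 1 1 one_pos) 0 1 1).1
  have h₂ : limitingAccessibility 2 (pathDigraph 1 1 one_pos) 1 1 = 0 :=
    limitingAccessibility_pathDigraph_succ 0 1
  norm_num [limitingAccessibility_pathDigraph_zero, h₂] at h₁

theorem not_metricRepresentability_limitingAccessibility :
    ¬ limitingAccessibility.MetricRepresentability := fun h => by
  have h₁ := ((h 2 one_lt_two (pathDigraph 1 1 one_pos)).2.1 0 1).1
  have h₂ : ∀ j, limitingAccessibility 2 (pathDigraph 1 1 one_pos) 1 j = 0 :=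
    limitingAccessibility_pathDigraph_succ 0
  exact absurd (h₁ (by simp [ProximityIndex.dist, limitingAccessibility_pathDigraph_zero, h₂]))
    (by decide)

theorem not_disconnectionForward_limitingAccessibility :
    ¬ limitingAccessibility.DisconnectionForward := fun h =>
  h 3 (by norm_num) (pathDigraph 2 1 one_pos) 1 2 (limitingAccessibility_pathDigraph_succ 0 2)
    (.single (pathDigraph_arc.2 rfl))

theorem not_monotonicityOneSecond_limitingAccessibility {r : ℝ → ℝ → Prop}
    (hr : ∀ x y, r x y → x ≥ y) : ¬ limitingAccessibility.MonotonicityOneSecond r := fun h => by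
  -- Raising the weight of `(1, 3)` from 1 to 2 leaves its own entry at 0, as 1 is never a root, but
  -- moves the entry `(0, 3)` from 1/2 to 2/3.
  have := hr _ _ (h 4 (by norm_num) _ _ 1 3
    (isArcIncrease_forkDigraph (hc := one_pos) (hc' := two_pos) one_lt_two) 0 3 (by decide))
  norm_num [limitingAccessibility_forkDigraph_one_three,
    limitingAccessibility_forkDigraph_zero_three] at this

end ProximityIndex

open ProximityIndex in
theorem proposition16 :
    limitingAccessibility.Nonnegativity ∧
    limitingAccessibility.DisconnectionBackward ∧
    -- satisfied in the nonstrict form only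
    (limitingAccessibility.DiagonalMaximality (· ≥ ·) ∧
      ¬ limitingAccessibility.DiagonalMaximality (· > ·)) ∧
    (limitingAccessibility.Transit (· ≥ ·) ∧ ¬ limitingAccessibility.Transit (· > ·)) ∧
    (limitingAccessibility.MonotonicityOneFirst (· ≥ ·) ∧
      ¬ limitingAccessibility.MonotonicityOneFirst (· > ·)) ∧
    (limitingAccessibility.MonotonicityTwo (· ≥ ·) ∧
      ¬ limitingAccessibility.MonotonicityTwo (· > ·)) ∧
    -- not satisfied, not even in the nonstrict form
    ¬ limitingAccessibility.Reversal ∧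
    (¬ limitingAccessibility.TriangleInequality (· > ·) ∧
      ¬ limitingAccessibility.TriangleInequality (· ≥ ·)) ∧
    ¬ limitingAccessibility.MetricRepresentability ∧
    ¬ limitingAccessibility.DisconnectionForward ∧
    (¬ limitingAccessibility.MonotonicityOneSecond (· > ·) ∧
      ¬ limitingAccessibility.MonotonicityOneSecond (· ≥ ·)) :=
  ⟨nonnegativity_limitingAccessibility,
    disconnectionBackward_limitingAccessibility,
    ⟨diagonalMaximality_limitingAccessibility, not_diagonalMaximality_limitingAccessibility⟩,
    ⟨transit_limitingAccessibility, not_transit_limitingAccessibility⟩,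
    ⟨monotonicityOneFirst_limitingAccessibility, not_monotonicityOneFirst_limitingAccessibility⟩,
    ⟨monotonicityTwo_limitingAccessibility, not_monotonicityTwo_limitingAccessibility⟩,
    not_reversal_limitingAccessibility,
    ⟨not_triangleInequality_limitingAccessibility _,
      not_triangleInequality_limitingAccessibility _⟩,
    not_metricRepresentability_limitingAccessibility,
    not_disconnectionForward_limitingAccessibility,
    ⟨not_monotonicityOneSecond_limitingAccessibility fun _ _ => le_of_lt,
      not_monotonicityOneSecond_limitingAccessibility fun _ _ => id⟩⟩
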